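/- All systems are compact metrizable spaces $X$ with a homeomorphism $T$; a factor map $(X,T)\to(Y,S)$ is a continuous map $\varphi$ with $\varphi\circ T=S\circ\varphi$; $h$ denotes topological entropy, $h(Y,S)=\sup_{\mathcal U}\lim_n \frac1n\log N\big(\bigvee_{i=1}^n S^i\mathcal U\big)$ over open covers $\mathcal U$, where $N$ is the minimal size of a subcover. The system $(X,T)$ has TCPE if every system $(Y,S)$ that is the image of $(X,T)$ under a surjective factor map satisfies $h(Y,S)>0$ or $|Y|=1$; it has ZTCPE if this holds for all such $(Y,S)$ with $Y$ zero-dimensional. A sequence $x\in\{0,1\}^{\mathbb Z}$ is balanced if the numbers of $1$s in any two subwords of $x$ of equal length differ by at most $1$. It has slope $\alpha\in[0,1]$ if for every $\varepsilon>0$ there is $N$ such that for $n>N$ every $n$-letter subword of $x$ has proportion of $1$s between $\alpha-\varepsilon$ and $\alpha+\varepsilon$. Let $B$ be the set of all balanced sequences and $B_\alpha$ the set of balanced sequences of slope $\alpha$. Let $*$ be a symbol not in $\{0,1\}$. For $X\subseteq\{0,1\}^{\mathbb Z}$ let $f(X)\subseteq\{0,1,*\}^{\mathbb Z}$ be the set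 of all sequences of the form $$\ldots a_{-1}\,*^{n_{-1}}\,a_0\,*^{n_0}\,a_1\,*^{n_1}\ldots,$$ where $(a_i)_{i\in\mathbb Z}$ is a shift of a point of $X$ and each $n_i\in\{2,3,4\}$. **Theorem.** The set $f(B)$ is a (nonempty) $\mathbb Z$-subshift, and with the shift $\sigma$ it has ZTCPE (every zero-dimensional factor of zero entropy is a single point) but not TCPE. Moreover, there is a surjective factor map $\pi:(f(B),\sigma)\to([0,1],\mathrm{id})$ such that for all $c\in f(B)$ and $\alpha\in[0,1]$, $\pi(c)=\alpha$ if and only if $c\in f(B_\alpha)$; that is, $\pi(c)$ is the slope of the balanced sequences from which $c$ arises. In particular, there is a $\mathbb Z$-subshift which has ZTCPE but not TCPE. -/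

import Mathlib

open SymbolicDynamics.FullShift

namespace TCPE

universe u

/-! ### Topological dynamical systems, entropy, TCPE and ZTCPE -/

section Systems

/-- The minimal size of a (finite) subcollection of `𝒰` which covers `Y`. -/
noncomputable def coverNumber {Y : Type u} (𝒰 : Set (Set Y)) : ℕ :=
  sInf {k : ℕ | ∃ s : Finset (Set Y),
    (s : Set (Set Y)) ⊆ 𝒰 ∧ ⋃₀ (s : Set (Set Y)) = Set.univ ∧ s.card = k}

/-- The common refinement of the covers `T 𝒰, T² 𝒰, …, Tⁿ 𝒰`. -/
def iteratedJoin {Y : Type u} [TopologicalSpace Y] (T : Y ≃ₜ Y) (𝒰 : Set (Set Y)) (n : ℕ) :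
    Set (Set Y) :=
  {V | ∃ c : ℕ → Set Y, (∀ i, c i ∈ 𝒰) ∧
    V = ⋂ i ∈ Finset.Icc 1 n, (fun y => (T ^ i) y) '' c i}

/-- `𝒰` is an open cover of `Y`. -/
def IsOpenCover' {Y : Type u} [TopologicalSpace Y] (𝒰 : Set (Set Y)) : Prop :=
  (∀ U ∈ 𝒰, IsOpen U) ∧ ⋃₀ 𝒰 = Set.univ

/-- Topological entropy by open covers. On a compact space the sequence is `1/n` times a
subadditive one, so that the upper limit is a limit. -/
noncomputable def topEntropy {Y : Type u} [TopologicalSpace Y] (T : Y ≃ₜ Y) : EReal :=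
  ⨆ (𝒰 : Set (Set Y)) (_ : IsOpenCover' 𝒰),
    Filter.limsup
      (fun n : ℕ => ((Real.log (coverNumber (iteratedJoin T 𝒰 n) : ℝ) / (n : ℝ) : ℝ) : EReal))
      Filter.atTop

/-- A factor map of systems: continuous and commuting with the homeomorphisms. -/
structure IsFactorMap {X Y : Type u} [TopologicalSpace X] [TopologicalSpace Y]
    (T : X ≃ₜ X) (S : Y ≃ₜ Y) (φ : X → Y) : Prop where
  continuous : Continuous φ
  commutes : ∀ x, φ (T x) = S (φ x)

/-- A space is zero-dimensional if its clopen sets form a basis of the topology. -/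
def IsZeroDimensional (Y : Type u) [TopologicalSpace Y] : Prop :=
  TopologicalSpace.IsTopologicalBasis {s : Set Y | IsClopen s}

/-- Topologically completely positive entropy. A surjective image of `X` has a copy in the
universe of `X`, so that all factors are covered. -/
def HasTCPE {X : Type u} [TopologicalSpace X] [CompactSpace X]
    [TopologicalSpace.MetrizableSpace X] (T : X ≃ₜ X) : Prop :=
  ∀ (Y : Type u) [TopologicalSpace Y] [CompactSpace Y] [TopologicalSpace.MetrizableSpace Y]
    (S : Y ≃ₜ Y) (φ : X → Y), IsFactorMap T S φ → Function.Surjective φ →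
      0 < topEntropy S ∨ Nat.card Y = 1

/-- Zero-dimensional topologically completely positive entropy. -/
def HasZTCPE {X : Type u} [TopologicalSpace X] [CompactSpace X]
    [TopologicalSpace.MetrizableSpace X] (T : X ≃ₜ X) : Prop :=
  ∀ (Y : Type u) [TopologicalSpace Y] [CompactSpace Y] [TopologicalSpace.MetrizableSpace Y]
    (S : Y ≃ₜ Y) (φ : X → Y), IsZeroDimensional Y →
      IsFactorMap T S φ → Function.Surjective φ →
        0 < topEntropy S ∨ Nat.card Y = 1

end Systems

/-! ### Subshifts over `ℤ` as dynamical systems -/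

section Shifts

instance instCompactSpaceSubshift {A : Type u} [TopologicalSpace A] [CompactSpace A]
    (X : Subshift A ℤ) : CompactSpace X.carrier :=
  isCompact_iff_compactSpace.mp X.isClosed.isCompact

/-- The shift `(σ x)(n) = x (n + 1)` on a `ℤ`-subshift. -/
noncomputable def shiftHomeo {A : Type u} [TopologicalSpace A] (X : Subshift A ℤ) :
    X.carrier ≃ₜ X.carrier where
  toFun x := ⟨shift 1 x.1, X.mapsTo 1 x.2⟩
  invFun x := ⟨shift (-1) x.1, X.mapsTo (-1) x.2⟩
  left_inv x := by ext n; simp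
  right_inv x := by ext n; simp
  continuous_toFun := by fun_prop
  continuous_invFun := by fun_prop

end Shifts

/-! ### Balanced sequences and slopes -/

section Balanced

/-- The number of symbols `1` in the `n`-letter subword `x([i, i + n - 1])`. -/
noncomputable def onesCount (x : ℤ → Fin 2) (i : ℤ) (n : ℕ) : ℕ :=
  ((Finset.Ico i (i + n)).filter (fun m => x m = 1)).card

/-- Any two subwords of the same length have numbers of `1`s within `k` of each other. -/
def IsKBalanced (k : ℕ) (x : ℤ → Fin 2) : Prop :=
  ∀ (n : ℕ) (i j : ℤ), |(onesCount x i n : ℤ) - (onesCount x j n : ℤ)| ≤ (k : ℤ)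

/-- The set `B` of all balanced (that is, `1`-balanced) sequences. -/
def balancedSet : Set (ℤ → Fin 2) := {x | IsKBalanced 1 x}

/-- `α` is the uniform frequency of `1`s in `x`. -/
def HasSlope (x : ℤ → Fin 2) (α : ℝ) : Prop :=
  ∀ ε : ℝ, 0 < ε → ∃ N : ℕ, ∀ n : ℕ, N < n → ∀ i : ℤ,
    α - ε ≤ (onesCount x i n : ℝ) / n ∧ (onesCount x i n : ℝ) / n ≤ α + ε

/-- The set `B_α` of balanced sequences of slope `α`. -/
def balancedSlopeSet (α : ℝ) : Set (ℤ → Fin 2) := {x | IsKBalanced 1 x ∧ HasSlope x α}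

end Balanced

/-! ### The gap-inserting black box -/

section BlackBox

/-- The alphabet `A` together with one new symbol, the gap symbol. -/
inductive Gapped (A : Type u) : Type u
  | gap : Gapped A
  | letter (a : A) : Gapped A

instance instFiniteGapped {A : Type u} [Finite A] : Finite (Gapped A) :=
  Finite.of_surjective (fun o : Option A => o.elim Gapped.gap Gapped.letter) (by
    rintro (_ | a)
    · exact ⟨none, rfl⟩
    · exact ⟨some a, rfl⟩)

instance instTopologicalSpaceGapped {A : Type u} : TopologicalSpace (Gapped A) := ⊥

instance instDiscreteTopologyGapped {A : Type u} : DiscreteTopology (Gapped A) := ⟨rfl⟩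

/-- The orbit of `x` under the shift action of `ℤ`. -/
def shiftOrbit {A : Type u} (x : ℤ → A) : Set (ℤ → A) := Set.range (fun t : ℤ => shift t x)

/-- `y` is the sequence `… a₋₁ gapⁿ⁻¹ a₀ gapⁿ⁰ a₁ gapⁿ¹ …`, where `p i` is the position in `y`
of the letter `aᵢ` and every gap length `n i` is `2`, `3` or `4`. -/
def IsGapInsertion {A : Type u} (a : ℤ → A) (y : ℤ → Gapped A) : Prop :=
  ∃ (n : ℤ → ℕ) (p : ℤ → ℤ),
    (∀ i, n i = 2 ∨ n i = 3 ∨ n i = 4) ∧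
    (∀ i, p (i + 1) = p i + (n i : ℤ) + 1) ∧
    (∀ i, y (p i) = Gapped.letter (a i)) ∧
    (∀ j, j ∉ Set.range p → y j = Gapped.gap)

/-- The black box `f` on the orbit of `x`. -/
def blackBoxPoint {A : Type u} (x : ℤ → A) : Set (ℤ → Gapped A) :=
  {y | ∃ a ∈ shiftOrbit x, IsGapInsertion a y}

/-- The black box `f` on a set of sequences: the union of `f` over the orbits of its points. -/
def blackBox {A : Type u} (X : Set (ℤ → A)) : Set (ℤ → Gapped A) :=
  ⋃ x ∈ X, blackBoxPoint x

end BlackBox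

end TCPE

/-! The gap insertions over a fixed balanced sequence have positive entropy, while the slope is a
continuous invariant with connected range. A point of `f(B)` determines its letters up to a shift,
hence its slope, and the slope has a closed graph over the compact interval (`isClosed_slopeGraph`).
So the slope is a factor map onto the identity of `[0,1]`, which has zero entropy, and TCPE fails.

For ZTCPE, let `W` be the preimage of a clopen set of a factor of zero entropy. If `W` separated two
gap insertions of one periodic sequence, long stretches of the two could be alternated freely
without disturbing the letters, forcing positive entropy (`mem_iff_of_periodic`). Balanced periodic
sequences are dense in `B`: mechanical sequences of rational slope suffice, and those of equal slope
are shifts of each other. Membership in `W` thus becomes a function of the rational slope. Since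
some mechanical sequence at each slope varies continuously with the slope, this function is locally
constant, even near irrational slopes, and connectedness of `(0,1)` makes it constant
(`mem_iff_of_locally_determined`). So clopen sets do not separate points of the factor, and a
zero-dimensional factor is a point. -/

namespace TCPE

universe u

/-! ### Gap insertions as explicit sequences -/

section GapInsertion

variable {A : Type u}

/-- The positions of the letters of a gap insertion: consecutive ones are at distance
`3`, `4` or `5`. -/
def IsGapPos (p : ℤ → ℤ) : Prop :=
  ∀ i, p i + 3 ≤ p (i + 1) ∧ p (i + 1) ≤ p i + 5

open Classical in
/-- The sequence with the letter `a i` at position `p i`, and gaps elsewhere. -/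
noncomputable def insertGaps (a : ℤ → A) (p : ℤ → ℤ) (j : ℤ) : Gapped A :=
  if h : ∃ i, p i = j then Gapped.letter (a h.choose) else Gapped.gap

lemma IsGapPos.strictMono {p : ℤ → ℤ} (hp : IsGapPos p) : StrictMono p :=
  strictMono_int_of_lt_succ fun i => by have := hp i; lia

lemma IsGapPos.const_add {p : ℤ → ℤ} (hp : IsGapPos p) (t s : ℤ) :
    IsGapPos fun i => p (t + i) + s := fun i => by
  have := hp (t + i)
  rw [add_assoc] at this
  constructor <;> simp only <;> lia

lemma IsGapPos.add_nat {p : ℤ → ℤ} (hp : IsGapPos p) (i : ℤ) (n : ℕ) :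
    p i + 3 * n ≤ p (i + n) ∧ p (i + n) ≤ p i + 5 * n := by
  induction n with
  | zero => simp
  | succ n ih =>
    have := hp (i + n)
    push_cast
    rw [← add_assoc]
    lia

lemma IsGapPos.add_int {p : ℤ → ℤ} (hp : IsGapPos p) (i : ℤ) {n : ℤ} (hn : 0 ≤ n) :
    p i + 3 * n ≤ p (i + n) ∧ p (i + n) ≤ p i + 5 * n := by
  lift n to ℕ using hn
  exact hp.add_nat i n

lemma IsGapPos.exists_le_lt {p : ℤ → ℤ} (hp : IsGapPos p) (j : ℤ) :
    ∃ s, p s ≤ j ∧ j < p (s + 1) := by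
  obtain ⟨s, hs, hmax⟩ := Int.exists_greatest_of_bdd (P := fun z => p z ≤ j)
    ⟨|j - p 0|, fun z hz => by
      by_contra! h
      have := hp.add_int 0 (n := z) (by grind)
      rw [zero_add] at this
      grind⟩
    ⟨-|j - p 0|, by
      have := hp.add_int (-|j - p 0|) (abs_nonneg (j - p 0))
      rw [neg_add_cancel] at this
      grind⟩
  exact ⟨s, hs, by by_contra! h; have := hmax _ h; lia⟩

lemma insertGaps_pos {a : ℤ → A} {p : ℤ → ℤ} (hp : p.Injective) (i : ℤ) :
    insertGaps a p (p i) = Gapped.letter (a i) := by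
  have h : ∃ k, p k = p i := ⟨i, rfl⟩
  rw [insertGaps, dif_pos h, hp h.choose_spec]

lemma insertGaps_of_notMem {a : ℤ → A} {p : ℤ → ℤ} {j : ℤ} (h : j ∉ Set.range p) :
    insertGaps a p j = Gapped.gap := dif_neg h

lemma insertGaps_ne_gap {a : ℤ → A} {p : ℤ → ℤ} {j : ℤ} :
    insertGaps a p j ≠ Gapped.gap ↔ j ∈ Set.range p := by
  by_cases h : ∃ i, p i = j
  · simp [insertGaps, Set.mem_range, h]
  · simp [insertGaps, Set.mem_range, h]

lemma eq_insertGaps {a : ℤ → A} {p : ℤ → ℤ} (hp : p.Injective) {y : ℤ → Gapped A}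
    (h₁ : ∀ i, y (p i) = Gapped.letter (a i)) (h₂ : ∀ j, j ∉ Set.range p → y j = Gapped.gap) :
    y = insertGaps a p := by
  ext1 j
  by_cases h : j ∈ Set.range p
  · obtain ⟨i, rfl⟩ := h
    rw [h₁, insertGaps_pos hp]
  · rw [h₂ j h, insertGaps_of_notMem h]

lemma isGapInsertion_iff {a : ℤ → A} {y : ℤ → Gapped A} :
    IsGapInsertion a y ↔ ∃ p, IsGapPos p ∧ y = insertGaps a p := by
  constructor
  · rintro ⟨n, p, hn, hp, h₁, h₂⟩
    have hp' : IsGapPos p := fun i => by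
      have := hn i
      have := hp i
      lia
    exact ⟨p, hp', eq_insertGaps hp'.strictMono.injective h₁ h₂⟩
  · rintro ⟨p, hp, rfl⟩
    refine ⟨fun i => (p (i + 1) - p i - 1).toNat, p, fun i => ?_, fun i => ?_,
      insertGaps_pos hp.strictMono.injective, fun j => insertGaps_of_notMem⟩
    · have := hp i
      lia
    · have := hp i
      lia

lemma shift_insertGaps {a : ℤ → A} {p : ℤ → ℤ} (hp : p.Injective) (t : ℤ) :
    shift t (insertGaps a p) = insertGaps a fun i => p i - t := by
  refine eq_insertGaps (fun i j h => hp (by simpa using h)) (fun i => ?_) fun j hj => ?_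
  · simp [insertGaps_pos hp]
  · refine insertGaps_of_notMem fun ⟨i, hi⟩ => hj ⟨i, ?_⟩
    simp [hi]

lemma insertGaps_reindex {a : ℤ → A} {p : ℤ → ℤ} (hp : p.Injective) (t : ℤ) :
    insertGaps a p = insertGaps (shift t a) fun i => p (t + i) := by
  refine eq_insertGaps (fun i j h => by simpa using hp h) (fun i => ?_) fun j hj => ?_
  · simp [insertGaps_pos hp]
  · refine insertGaps_of_notMem fun ⟨i, hi⟩ => hj ⟨i - t, ?_⟩
    simp [hi]

/-- The letters of a gap insertion are determined up to a shift. -/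
lemma insertGaps_inj {a b : ℤ → A} {p q : ℤ → ℤ} (hp : StrictMono p) (hq : StrictMono q)
    (h : insertGaps a p = insertGaps b q) : ∃ s, b = shift s a := by
  have hr : ∀ j, j ∈ Set.range p ↔ j ∈ Set.range q := fun j => by
    rw [← insertGaps_ne_gap (a := a), ← insertGaps_ne_gap (a := b), h]
  obtain ⟨s, hs⟩ := (hr (q 0)).2 ⟨0, rfl⟩
  -- Two increasing enumerations of the same set that agree at one index agree everywhere: neither
  -- can skip an element that the other hits.
  have key : ∀ i, p (s + i) = q i := by
    intro i
    induction i with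
    | zero => simpa using hs
    | succ i ih =>
      obtain ⟨k, hk⟩ := (hr (q (i + 1))).2 ⟨_, rfl⟩
      obtain ⟨l, hl⟩ := (hr (p (s + (i + 1)))).1 ⟨_, rfl⟩
      have h1 : q i < q (i + 1) := hq (by lia)
      have h2 : p (s + i) < p (s + (i + 1)) := hp (by lia)
      rw [← hk, ← ih, hp.lt_iff_lt] at h1
      rw [← hl, ih, hq.lt_iff_lt] at h2
      apply le_antisymm
      · rw [← hk]; exact hp.monotone (by lia)
      · rw [← hl]; exact hq.monotone (by lia)
    | pred i ih =>
      obtain ⟨k, hk⟩ := (hr (q (-(i : ℤ) - 1))).2 ⟨_, rfl⟩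
      obtain ⟨l, hl⟩ := (hr (p (s + (-(i : ℤ) - 1)))).1 ⟨_, rfl⟩
      have h1 : q (-(i : ℤ) - 1) < q (-(i : ℤ)) := hq (by lia)
      have h2 : p (s + (-(i : ℤ) - 1)) < p (s + -(i : ℤ)) := hp (by lia)
      rw [← hk, ← ih, hp.lt_iff_lt] at h1
      rw [← hl, ih, hq.lt_iff_lt] at h2
      apply le_antisymm
      · rw [← hl]; exact hq.monotone (by lia)
      · rw [← hk]; exact hp.monotone (by lia)
  refine ⟨s, funext fun i => ?_⟩
  have := congrFun h (q i)
  rw [insertGaps_pos hq.injective, ← key i, insertGaps_pos hp.injective] at this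
  simpa using this.symm

/-- Sequences which are built from the same data on an interval agree there. -/
lemma insertGaps_congr {a b : ℤ → A} {p q : ℤ → ℤ} (hp : StrictMono p) (hq : StrictMono q)
    {m n s d : ℤ} (hpq : ∀ i, m ≤ i → i ≤ n → q (s + i) = p i + d)
    (hab : ∀ i, m ≤ i → i ≤ n → b (s + i) = a i) (hmn : m ≤ n) {j : ℤ}
    (hj₁ : p m ≤ j) (hj₂ : j ≤ p n) :
    insertGaps b q (j + d) = insertGaps a p j := by
  by_cases h : j ∈ Set.range p
  · obtain ⟨i, rfl⟩ := h
    have h₁ := hp.le_iff_le.1 hj₁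
    have h₂ := hp.le_iff_le.1 hj₂
    rw [insertGaps_pos hp.injective, ← hpq i h₁ h₂, insertGaps_pos hq.injective, hab i h₁ h₂]
  · rw [insertGaps_of_notMem h, insertGaps_of_notMem]
    rintro ⟨k, hk⟩
    have h₁ : s + m ≤ k := hq.le_iff_le.1 (by rw [hk, hpq m le_rfl hmn]; lia)
    have h₂ : k ≤ s + n := hq.le_iff_le.1 (by rw [hk, hpq n hmn le_rfl]; lia)
    have := hpq (k - s) (by lia) (by lia)
    rw [add_sub_cancel] at this
    exact h ⟨k - s, by lia⟩

lemma mem_blackBox_iff {X : Set (ℤ → A)} (hX : ∀ t, Set.MapsTo (shift t) X X)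
    {y : ℤ → Gapped A} :
    y ∈ blackBox X ↔ ∃ a ∈ X, ∃ p, IsGapPos p ∧ y = insertGaps a p := by
  simp only [blackBox, blackBoxPoint, Set.mem_iUnion, Set.mem_ofPred_eq, isGapInsertion_iff]
  constructor
  · rintro ⟨x, hx, _, ⟨t, rfl⟩, h⟩
    exact ⟨_, hX t hx, h⟩
  · rintro ⟨a, ha, h⟩
    exact ⟨a, ha, a, ⟨0, by simp⟩, h⟩

lemma mapsTo_shift_blackBox {X : Set (ℤ → A)} (hX : ∀ t, Set.MapsTo (shift t) X X) (t : ℤ) :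
    Set.MapsTo (shift t) (blackBox X) (blackBox X) := by
  intro y hy
  rw [mem_blackBox_iff hX] at hy ⊢
  obtain ⟨a, ha, p, hp, rfl⟩ := hy
  refine ⟨a, ha, fun i => p i - t, fun i => ?_, shift_insertGaps hp.strictMono.injective t⟩
  have := hp i
  constructor <;> simp only <;> lia

end GapInsertion

/-! ### Counting ones, and the slope of a balanced sequence -/

section Slopes

lemma onesCount_zero (x : ℤ → Fin 2) (i : ℤ) : onesCount x i 0 = 0 := by
  simp [onesCount]

lemma onesCount_succ (x : ℤ → Fin 2) (i : ℤ) (n : ℕ) :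
    onesCount x i (n + 1) = onesCount x i n + (x (i + n)).val := by
  have h : Finset.Ico i (i + (n + 1 : ℕ)) = insert (i + n) (Finset.Ico i (i + n)) := by
    ext k
    simp only [Finset.mem_Ico, Finset.mem_insert]
    lia
  rw [onesCount, h, Finset.filter_insert]
  by_cases hx : x (i + n) = 1
  · rw [if_pos hx, Finset.card_insert_of_notMem (by simp), hx]
    rfl
  · rw [if_neg hx, show (x (i + n)).val = 0 by lia]
    rfl

lemma onesCount_add (x : ℤ → Fin 2) (i : ℤ) (m n : ℕ) :
    onesCount x i (m + n) = onesCount x i m + onesCount x (i + m) n := by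
  induction n with
  | zero => simp [onesCount_zero]
  | succ n ih =>
    rw [← add_assoc, onesCount_succ, onesCount_succ, ih]
    push_cast
    rw [add_assoc, add_assoc]

lemma onesCount_le (x : ℤ → Fin 2) (i : ℤ) (n : ℕ) : onesCount x i n ≤ n := by
  induction n with
  | zero => simp [onesCount_zero]
  | succ n ih => rw [onesCount_succ]; lia

lemma onesCount_shift (x : ℤ → Fin 2) (t i : ℤ) (n : ℕ) :
    onesCount (shift t x) i n = onesCount x (t + i) n := by
  induction n with
  | zero => simp [onesCount_zero]
  | succ n ih => rw [onesCount_succ, onesCount_succ, ih, shift_apply, add_assoc]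

lemma le_onesCount_mul {x : ℤ → Fin 2} {n L : ℕ} (h : ∀ i, L ≤ onesCount x i n) (i : ℤ) (m : ℕ) :
    m * L ≤ onesCount x i (m * n) := by
  induction m with
  | zero => simp
  | succ m ih => rw [Nat.succ_mul, Nat.succ_mul, onesCount_add]; exact add_le_add ih (h _)

lemma onesCount_mul_le {x : ℤ → Fin 2} {n L : ℕ} (h : ∀ i, onesCount x i n ≤ L) (i : ℤ) (m : ℕ) :
    onesCount x i (m * n) ≤ m * L := by
  induction m with
  | zero => simp [onesCount_zero]
  | succ m ih => rw [Nat.succ_mul, Nat.succ_mul, onesCount_add]; exact add_le_add ih (h _)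

lemma IsKBalanced.le_add {x : ℤ → Fin 2} (hx : IsKBalanced 1 x) (n : ℕ) (i j : ℤ) :
    onesCount x i n ≤ onesCount x j n + 1 := by
  have := abs_le.1 (hx n i j)
  lia

/-- The lower estimates for the slope are strictly below the upper estimates. -/
lemma IsKBalanced.cross_lt {x : ℤ → Fin 2} (hx : IsKBalanced 1 x) {m n : ℕ} (hm : 0 < m)
    (hn : 0 < n) (i j : ℤ) :
    ((onesCount x i m : ℤ) - 1) * n < (onesCount x j n + 1) * m := by
  by_contra! hlt
  obtain hc | ⟨c, hc⟩ := Nat.eq_zero_or_eq_succ_pred (onesCount x i m) |>.imp_right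
    fun h => (⟨_, h⟩ : ∃ c, onesCount x i m = c + 1)
  · rw [hc] at hlt
    push_cast at hlt
    nlinarith [Int.natCast_nonneg (onesCount x j n * m), mul_comm (onesCount x j n) m]
  -- Count the ones of a window of length `m * n` twice. As `m` blocks of length `n` it has at most
  -- `m * (onesCount x j n + 1)`; as `n` blocks of length `m`, the first with `c + 1` ones, it has
  -- at least `n * c + 1`.
  have h₁ : ∀ k, c ≤ onesCount x k m := fun k => by have := hx.le_add m i k; lia
  have h₂ := fun k => hx.le_add n k j
  have h₃ := onesCount_mul_le h₂ i m
  obtain ⟨n, rfl⟩ := Nat.exists_eq_succ_of_ne_zero hn.ne'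
  have h₄ := le_onesCount_mul h₁ (i + m) n
  rw [show m * n.succ = m + n * m by rw [Nat.succ_eq_add_one]; ring, onesCount_add, hc] at h₃
  rw [hc] at hlt
  push_cast at hlt
  zify at h₃ h₄
  nlinarith

/-- The numbers of ones in all subwords differ from those predicted by `α` by at most one. -/
def HasCloseSlope (x : ℤ → Fin 2) (α : ℝ) : Prop :=
  ∀ (n : ℕ) (i : ℤ), |(onesCount x i n : ℝ) - n * α| ≤ 1

lemma HasCloseSlope.hasSlope {x : ℤ → Fin 2} {α : ℝ} (h : HasCloseSlope x α) : HasSlope x α := by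
  intro ε hε
  obtain ⟨N, hN⟩ := exists_nat_gt (1 / ε)
  refine ⟨N, fun n hn i => ?_⟩
  have hn' : (0 : ℝ) < n := by exact_mod_cast (Nat.zero_le N).trans_lt hn
  have hNn : (N : ℝ) < n := by exact_mod_cast hn
  have h1 : 1 ≤ ε * n := by
    rw [div_lt_iff₀ hε] at hN
    nlinarith
  have h2 := abs_le.1 (h n i)
  rw [le_div_iff₀ hn', div_le_iff₀ hn']
  constructor <;> nlinarith

lemma HasSlope.unique {x : ℤ → Fin 2} {α β : ℝ} (hα : HasSlope x α) (hβ : HasSlope x β) :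
    α = β := by
  refine eq_of_forall_dist_le fun ε hε => ?_
  obtain ⟨M, hM⟩ := hα (ε / 2) (by positivity)
  obtain ⟨N, hN⟩ := hβ (ε / 2) (by positivity)
  have h1 := hM (max M N + 1) (by lia) 0
  have h2 := hN (max M N + 1) (by lia) 0
  rw [Real.dist_eq, abs_le]
  constructor <;> linarith

lemma HasSlope.shift {x : ℤ → Fin 2} {α : ℝ} (h : HasSlope x α) (t : ℤ) :
    HasSlope (shift t x) α := by
  intro ε hε
  obtain ⟨N, hN⟩ := h ε hε
  exact ⟨N, fun n hn i => by rw [onesCount_shift]; exact hN n hn _⟩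

lemma HasCloseSlope.shift {x : ℤ → Fin 2} {α : ℝ} (h : HasCloseSlope x α) (t : ℤ) :
    HasCloseSlope (shift t x) α := fun n i => by
  rw [onesCount_shift]; exact h n _

lemma IsKBalanced.shift {x : ℤ → Fin 2} {k : ℕ} (h : IsKBalanced k x) (t : ℤ) :
    IsKBalanced k (shift t x) := fun n i j => by
  rw [onesCount_shift, onesCount_shift]; exact h n _ _

/-- By `IsKBalanced.cross_lt` every lower estimate `(count - 1) / m` is below every upper estimate
`(count + 1) / n`, so the supremum of the lower ones meets all bounds at once. -/
lemma IsKBalanced.exists_hasCloseSlope {x : ℤ → Fin 2} (hx : IsKBalanced 1 x) :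
    ∃ α ∈ Set.Icc (0 : ℝ) 1, HasCloseSlope x α := by
  have cross : ∀ (m n : ℕ) (i j : ℤ), 0 < m → 0 < n →
      ((onesCount x i m : ℝ) - 1) / m ≤ (onesCount x j n + 1) / n := by
    intro m n i j hm hn
    rw [div_le_div_iff₀ (by positivity) (by positivity)]
    exact_mod_cast (hx.cross_lt hm hn i j).le
  let S : Set ℝ := {r | ∃ (m : ℕ) (i : ℤ), 0 < m ∧ r = ((onesCount x i m : ℝ) - 1) / m}
  have hne : S.Nonempty := ⟨_, 1, 0, one_pos, rfl⟩
  have hup : ∀ (n : ℕ) (j : ℤ), 0 < n → ∀ r ∈ S, r ≤ (onesCount x j n + 1) / n := by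
    rintro n j hn _ ⟨m, i, hm, rfl⟩
    exact cross m n i j hm hn
  have hbdd : BddAbove S := ⟨_, fun r hr => hup 1 0 one_pos r hr⟩
  have hclose : HasCloseSlope x (sSup S) := by
    intro n i
    rcases Nat.eq_zero_or_pos n with rfl | hn
    · simp [onesCount_zero]
    have hn' : (0 : ℝ) < n := by exact_mod_cast hn
    have h1 : ((onesCount x i n : ℝ) - 1) / n ≤ sSup S := le_csSup hbdd ⟨n, i, hn, rfl⟩
    have h2 : sSup S ≤ (onesCount x i n + 1) / n := csSup_le hne (hup n i hn)
    rw [div_le_iff₀ hn'] at h1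
    rw [le_div_iff₀ hn'] at h2
    rw [abs_le]
    constructor <;> linarith
  have hs := hclose.hasSlope
  refine ⟨sSup S, ⟨?_, ?_⟩, hclose⟩
  · refine le_of_forall_pos_le_add fun ε hε => ?_
    obtain ⟨N, hN⟩ := hs ε hε
    have := (hN (N + 1) (by lia) 0).2
    exact le_trans (by positivity) this
  · refine le_of_forall_pos_le_add fun ε hε => ?_
    obtain ⟨N, hN⟩ := hs ε hε
    have h1 := (hN (N + 1) (by lia) 0).1
    have h2 : (onesCount x 0 (N + 1) : ℝ) / ((N + 1 : ℕ) : ℝ) ≤ 1 :=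
      div_le_one_of_le₀ (by exact_mod_cast onesCount_le x 0 (N + 1)) (by positivity)
    linarith

/-- This trades an asymptotic condition for one that is closed in `(x, α)`, as the compactness
arguments need. -/
lemma IsKBalanced.hasSlope_iff {x : ℤ → Fin 2} (hx : IsKBalanced 1 x) {α : ℝ} :
    HasSlope x α ↔ HasCloseSlope x α := by
  refine ⟨fun h => ?_, HasCloseSlope.hasSlope⟩
  obtain ⟨β, -, hβ⟩ := hx.exists_hasCloseSlope
  rwa [h.unique hβ.hasSlope]

end Slopes

/-! ### Mechanical sequences -/

section Mechanical

/-- The mechanical sequence `n ↦ ⌊β (n + 1) + ρ⌋ - ⌊β n + ρ⌋` of a slope `β ∈ [0, 1]`. -/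
noncomputable def mechanical (β ρ : ℝ) (n : ℤ) : Fin 2 :=
  if ⌊β * (n + 1) + ρ⌋ = ⌊β * n + ρ⌋ then 0 else 1

lemma mechanical_val {β : ℝ} (hβ : β ∈ Set.Icc (0 : ℝ) 1) (ρ : ℝ) (n : ℤ) :
    ((mechanical β ρ n).val : ℤ) = ⌊β * (n + 1) + ρ⌋ - ⌊β * n + ρ⌋ := by
  have h1 : ⌊β * n + ρ⌋ ≤ ⌊β * (n + 1) + ρ⌋ := Int.floor_mono (by linarith [hβ.1])
  have h2 : ⌊β * (n + 1) + ρ⌋ ≤ ⌊β * n + ρ⌋ + 1 := by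
    rw [← Int.floor_add_one]
    exact Int.floor_mono (by linarith [hβ.2])
  unfold mechanical
  split_ifs with h
  · simp [h]
  · simp only [Fin.val_one, Nat.cast_one]
    lia

lemma onesCount_mechanical {β : ℝ} (hβ : β ∈ Set.Icc (0 : ℝ) 1) (ρ : ℝ) (i : ℤ) (n : ℕ) :
    (onesCount (mechanical β ρ) i n : ℤ) = ⌊β * (i + n) + ρ⌋ - ⌊β * i + ρ⌋ := by
  induction n with
  | zero => simp [onesCount_zero]
  | succ n ih =>
    rw [onesCount_succ]
    push_cast
    rw [ih, mechanical_val hβ]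
    push_cast
    rw [add_assoc (i : ℝ)]
    ring

lemma hasCloseSlope_mechanical {β : ℝ} (hβ : β ∈ Set.Icc (0 : ℝ) 1) (ρ : ℝ) :
    HasCloseSlope (mechanical β ρ) β := by
  intro n i
  have h := onesCount_mechanical hβ ρ i n
  have h' : (onesCount (mechanical β ρ) i n : ℝ) = ⌊β * (i + n) + ρ⌋ - ⌊β * i + ρ⌋ := by
    exact_mod_cast h
  rw [h', abs_le]
  have h1 := Int.floor_le (β * (i + n) + ρ)
  have h2 := Int.lt_floor_add_one (β * (i + n) + ρ)
  have h3 := Int.floor_le (β * i + ρ)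
  have h4 := Int.lt_floor_add_one (β * i + ρ)
  constructor <;> linarith

lemma isKBalanced_mechanical {β : ℝ} (hβ : β ∈ Set.Icc (0 : ℝ) 1) (ρ : ℝ) :
    IsKBalanced 1 (mechanical β ρ) := by
  have key : ∀ (n : ℕ) (i : ℤ),
      ⌊β * n⌋ ≤ (onesCount (mechanical β ρ) i n : ℤ) ∧
        (onesCount (mechanical β ρ) i n : ℤ) ≤ ⌊β * n⌋ + 1 := by
    intro n i
    rw [onesCount_mechanical hβ, show β * (i + n) + ρ = (β * i + ρ) + β * n by ring]
    have h1 := Int.le_floor_add (β * i + ρ) (β * n)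
    have h2 := Int.le_floor_add_floor (β * i + ρ) (β * n)
    lia
  intro n i j
  have h1 := key n i
  have h2 := key n j
  rw [abs_le]
  lia

lemma shift_mechanical (β ρ : ℝ) (t : ℤ) :
    shift t (mechanical β ρ) = mechanical β (β * t + ρ) := by
  ext1 n
  simp only [shift_apply, mechanical]
  push_cast
  rw [show β * (t + n + 1) + ρ = β * (n + 1) + (β * t + ρ) by ring,
    show β * (t + n) + ρ = β * n + (β * t + ρ) by ring]

lemma mechanical_add_int (β ρ : ℝ) (k : ℤ) : mechanical β (ρ + k) = mechanical β ρ := by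
  ext1 n
  simp only [mechanical, ← add_assoc, Int.floor_add_intCast, add_left_inj]

end Mechanical

/-! ### The subshift `f(B)` and its slope map -/

section SlopeMap

lemma mapsTo_shift_balancedSet (t : ℤ) : Set.MapsTo (shift t) balancedSet balancedSet :=
  fun _ hx => IsKBalanced.shift hx t

lemma mapsTo_shift_balancedSlopeSet (α : ℝ) (t : ℤ) :
    Set.MapsTo (shift t) (balancedSlopeSet α) (balancedSlopeSet α) :=
  fun _ hx => ⟨hx.1.shift t, hx.2.shift t⟩

lemma continuous_onesCount (i : ℤ) (n : ℕ) :
    Continuous fun x : ℤ → Fin 2 => onesCount x i n := by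
  induction n with
  | zero => simp only [onesCount_zero]; exact continuous_const
  | succ n ih =>
    simp only [onesCount_succ]
    exact ih.add (continuous_of_discreteTopology.comp (continuous_apply (i + n)))

lemma isClosed_balanced : IsClosed {x : ℤ → Fin 2 | IsKBalanced 1 x} := by
  simp only [IsKBalanced, Set.ofPred_forall]
  refine isClosed_iInter fun n => isClosed_iInter fun i => isClosed_iInter fun j => ?_
  have h : Continuous fun x : ℤ → Fin 2 => (onesCount x i n, onesCount x j n) :=
    (continuous_onesCount i n).prodMk (continuous_onesCount j n)
  exact (isClosed_discrete {z : ℕ × ℕ | |(z.1 : ℤ) - (z.2 : ℤ)| ≤ ((1 : ℕ) : ℤ)}).preimage h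

lemma isClosed_hasCloseSlope :
    IsClosed {z : (ℤ → Fin 2) × ℝ | HasCloseSlope z.1 z.2} := by
  simp only [HasCloseSlope, Set.ofPred_forall]
  refine isClosed_iInter fun n => isClosed_iInter fun i => ?_
  have h : Continuous fun z : (ℤ → Fin 2) × ℝ => (onesCount z.1 i n : ℝ) :=
    continuous_of_discreteTopology.comp ((continuous_onesCount i n).comp continuous_fst)
  exact isClosed_le (by fun_prop) continuous_const

lemma mem_blackBox_balancedSlopeSet {y : ℤ → Gapped (Fin 2)} {α : ℝ} :
    y ∈ blackBox (balancedSlopeSet α) ↔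
      ∃ a, IsKBalanced 1 a ∧ HasCloseSlope a α ∧ ∃ p, IsGapPos p ∧ y = insertGaps a p := by
  rw [mem_blackBox_iff (mapsTo_shift_balancedSlopeSet α)]
  constructor
  · rintro ⟨a, ha, h⟩
    exact ⟨a, ha.1, ha.1.hasSlope_iff.1 ha.2, h⟩
  · rintro ⟨a, ha, ha', h⟩
    exact ⟨a, ⟨ha, ha'.hasSlope⟩, h⟩

/-- The witnesses `(a, p)` can be confined to a compact space, on which the defining conditions are
closed; projecting them away is a closed map. -/
lemma isClosed_slopeGraph :
    IsClosed {z : (ℤ → Gapped (Fin 2)) × ℝ | z.1 ∈ blackBox (balancedSlopeSet z.2)} := by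
  -- Reindexing so that `p 0 ≤ 0 < p 1` gives `-4 ≤ p 0 ≤ 0`, and each step is at most `5`.
  let P : Type := ∀ i : ℤ, Set.Icc (-4 - 5 * |i|) (5 * |i|)
  let K : Set (((ℤ → Fin 2) × P) × ((ℤ → Gapped (Fin 2)) × ℝ)) :=
    {w | IsKBalanced 1 w.1.1 ∧ HasCloseSlope w.1.1 w.2.2 ∧ IsGapPos (fun i => (w.1.2 i : ℤ)) ∧
      (∀ i j, (w.1.2 i : ℤ) = j → w.2.1 j = Gapped.letter (w.1.1 i)) ∧
      ∀ i j, (w.1.2 i : ℤ) < j ∧ j < w.1.2 (i + 1) → w.2.1 j = Gapped.gap}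
  have hcont : ∀ i, Continuous fun w : ((ℤ → Fin 2) × P) × ((ℤ → Gapped (Fin 2)) × ℝ) =>
      (w.1.2 i : ℤ) := fun i =>
    continuous_subtype_val.comp
      ((continuous_apply (A := fun i : ℤ => Set.Icc (-4 - 5 * |i|) (5 * |i|)) i).comp
        (continuous_snd.comp continuous_fst))
  have hpair : ∀ i, Continuous fun w : ((ℤ → Fin 2) × P) × ((ℤ → Gapped (Fin 2)) × ℝ) =>
      ((w.1.2 i : ℤ), (w.1.2 (i + 1) : ℤ)) := fun i => (hcont i).prodMk (hcont (i + 1))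
  have hK : IsClosed K := by
    simp only [K, Set.ofPred_and]
    refine (isClosed_balanced.preimage (by fun_prop)).inter <| (isClosed_hasCloseSlope.preimage
      (f := fun w : ((ℤ → Fin 2) × P) × ((ℤ → Gapped (Fin 2)) × ℝ) => (w.1.1, w.2.2))
      (by fun_prop)).inter <| IsClosed.inter ?_ <| IsClosed.inter ?_ ?_
    · simp only [IsGapPos, Set.ofPred_forall]
      exact isClosed_iInter fun i => (isClosed_discrete
        {z : ℤ × ℤ | z.1 + 3 ≤ z.2 ∧ z.2 ≤ z.1 + 5}).preimage (hpair i)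
    · simp only [Set.ofPred_forall]
      refine isClosed_iInter fun i => isClosed_iInter fun j => isClosed_imp
        ((isOpen_discrete {z : ℤ | z = j}).preimage (hcont i)) (isClosed_eq (by fun_prop) ?_)
      exact continuous_of_discreteTopology.comp
        ((continuous_apply i).comp (continuous_fst.comp continuous_fst))
    · simp only [Set.ofPred_forall]
      refine isClosed_iInter fun i => isClosed_iInter fun j => isClosed_imp
        ((isOpen_discrete {z : ℤ × ℤ | z.1 < j ∧ j < z.2}).preimage (hpair i))
        (isClosed_eq (by fun_prop) continuous_const)
  have : CompactSpace P := Pi.compactSpace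
  convert isClosedMap_snd_of_compactSpace K hK using 1
  ext ⟨y, α⟩
  simp only [Set.mem_ofPred_eq, mem_blackBox_balancedSlopeSet, Set.mem_image, Prod.exists]
  constructor
  · rintro ⟨a, ha, ha', p, hp, rfl⟩
    obtain ⟨s, hs₁, hs₂⟩ := hp.exists_le_lt 0
    have hq : IsGapPos fun i => p (s + i) := by simpa using hp.const_add s 0
    have hs := hp s
    have hbd : ∀ i, p (s + i) ∈ Set.Icc (-4 - 5 * |i|) (5 * |i|) := by
      intro i
      rw [Set.mem_Icc]
      rcases le_total 0 i with hi | hi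
      · have := hp.add_int s hi
        rw [abs_of_nonneg hi]
        lia
      · have := hp.add_int (s + i) (n := -i) (by lia)
        rw [add_neg_cancel_right] at this
        rw [abs_of_nonpos hi]
        lia
    refine ⟨shift s a, fun i => ⟨p (s + i), hbd i⟩, _, _,
      ⟨ha.shift s, ha'.shift s, hq, ?_, ?_⟩, rfl⟩
    · rintro i _ rfl
      exact insertGaps_pos hp.strictMono.injective _
    · rintro i j ⟨h1, h2⟩
      refine insertGaps_of_notMem ?_
      rintro ⟨k, rfl⟩
      simp only [hp.strictMono.lt_iff_lt] at h1 h2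
      lia
  · rintro ⟨a, p, y, α, ⟨ha, ha', hp, h₁, h₂⟩, h⟩
    obtain ⟨rfl, rfl⟩ := Prod.mk.inj h
    refine ⟨a, ha, ha', _, hp, eq_insertGaps hp.strictMono.injective (fun i => h₁ i _ rfl)
      fun j hj => ?_⟩
    obtain ⟨s, hs₁, hs₂⟩ := hp.exists_le_lt j
    exact h₂ s j ⟨lt_of_le_of_ne hs₁ fun h => hj ⟨s, h⟩, hs₂⟩

/-- Uniqueness holds because the letters are determined up to a shift, which preserves the slope. -/
lemma existsUnique_slope {y : ℤ → Gapped (Fin 2)} (hy : y ∈ blackBox balancedSet) :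
    ∃! α : unitInterval, y ∈ blackBox (balancedSlopeSet (α : ℝ)) := by
  rw [mem_blackBox_iff mapsTo_shift_balancedSet] at hy
  obtain ⟨a, ha, p, hp, rfl⟩ := hy
  obtain ⟨α, hα, hslope⟩ := IsKBalanced.exists_hasCloseSlope ha
  refine ⟨⟨α, hα⟩, mem_blackBox_balancedSlopeSet.2 ⟨a, ha, hslope, p, hp, rfl⟩, ?_⟩
  rintro ⟨β, hβ⟩ h
  obtain ⟨b, -, hb, q, hq, h⟩ := mem_blackBox_balancedSlopeSet.1 h
  obtain ⟨s, rfl⟩ := insertGaps_inj hp.strictMono hq.strictMono h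
  exact Subtype.ext (hb.hasSlope.unique (hslope.shift s).hasSlope)

lemma blackBox_balancedSlopeSet_subset (α : ℝ) :
    blackBox (balancedSlopeSet α) ⊆ blackBox balancedSet :=
  Set.biUnion_subset_biUnion_left fun _ hx => hx.1

lemma isClosed_blackBox_balancedSet : IsClosed (blackBox balancedSet) := by
  have h : IsClosed {z : (ℤ → Gapped (Fin 2)) × unitInterval |
      z.1 ∈ blackBox (balancedSlopeSet (z.2 : ℝ))} :=
    isClosed_slopeGraph.preimage
      (f := fun z : (ℤ → Gapped (Fin 2)) × unitInterval => (z.1, (z.2 : ℝ))) (by fun_prop)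
  convert isClosedMap_fst_of_compactSpace _ h using 1
  ext y
  simp only [Set.mem_image, Set.mem_ofPred_eq, Prod.exists, exists_and_right, exists_eq_right]
  exact ⟨fun hy => (existsUnique_slope hy).exists,
    fun ⟨α, hα⟩ => blackBox_balancedSlopeSet_subset _ hα⟩

/-- The subshift `f(B)`. -/
def gappedBalanced : Subshift (Gapped (Fin 2)) ℤ where
  carrier := blackBox balancedSet
  isClosed := isClosed_blackBox_balancedSet
  mapsTo := mapsTo_shift_blackBox mapsTo_shift_balancedSet

/-- The slope of the balanced sequences from which a point of `f(B)` arises. -/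
noncomputable def slope (c : gappedBalanced.carrier) : unitInterval :=
  (existsUnique_slope c.2).choose

lemma slope_eq_iff {c : gappedBalanced.carrier} {α : unitInterval} :
    slope c = α ↔ (c : ℤ → Gapped (Fin 2)) ∈ blackBox (balancedSlopeSet (α : ℝ)) := by
  have h := (existsUnique_slope c.2).choose_spec
  exact ⟨fun hα => hα ▸ h.1, fun hα => (h.2 α hα).symm⟩

/-- A map into a compact space with closed graph is continuous. -/
lemma continuous_slope : Continuous slope := by
  refine continuous_iff_isClosed.2 fun C hC => ?_
  have h : IsClosed {z : gappedBalanced.carrier × unitInterval |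
      (z.1 : ℤ → Gapped (Fin 2)) ∈ blackBox (balancedSlopeSet (z.2 : ℝ)) ∧ z.2 ∈ C} :=
    (isClosed_slopeGraph.preimage (f := fun z : gappedBalanced.carrier × unitInterval =>
      ((z.1 : ℤ → Gapped (Fin 2)), (z.2 : ℝ))) (by fun_prop)).inter (hC.preimage continuous_snd)
  convert isClosedMap_fst_of_compactSpace _ h using 1
  ext c
  simp [← slope_eq_iff]

lemma isFactorMap_slope :
    IsFactorMap (shiftHomeo gappedBalanced) (Homeomorph.refl unitInterval) slope := by
  refine ⟨continuous_slope, fun c => ?_⟩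
  rw [slope_eq_iff]
  exact mapsTo_shift_blackBox (mapsTo_shift_balancedSlopeSet _) 1 (slope_eq_iff.1 rfl)

lemma isGapPos_three_mul : IsGapPos fun i => 3 * i := fun i => by
  constructor <;> simp only <;> lia

lemma insertGaps_mem_gappedBalanced {a : ℤ → Fin 2} (ha : IsKBalanced 1 a) {p : ℤ → ℤ}
    (hp : IsGapPos p) : insertGaps a p ∈ gappedBalanced.carrier :=
  (mem_blackBox_iff mapsTo_shift_balancedSet).2 ⟨a, ha, p, hp, rfl⟩

lemma surjective_slope : Function.Surjective slope := fun α =>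
  ⟨⟨_, insertGaps_mem_gappedBalanced (isKBalanced_mechanical α.2 0) isGapPos_three_mul⟩,
    slope_eq_iff.2 (mem_blackBox_balancedSlopeSet.2
      ⟨_, isKBalanced_mechanical α.2 0, hasCloseSlope_mechanical α.2 0, _, isGapPos_three_mul,
        rfl⟩)⟩

end SlopeMap

/-! ### Two estimates of entropy -/

section Entropy

variable {Y : Type u} [TopologicalSpace Y]

lemma coverNumber_le {Y : Type u} {𝒰 : Set (Set Y)} {s : Finset (Set Y)} (hs : (s : Set (Set Y)) ⊆ 𝒰)
    (hcov : ⋃₀ (s : Set (Set Y)) = Set.univ) : coverNumber 𝒰 ≤ s.card :=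
  Nat.sInf_le ⟨s, hs, hcov, rfl⟩

lemma IsOpenCover'.exists_finset [CompactSpace Y] {𝒰 : Set (Set Y)} (h : IsOpenCover' 𝒰) :
    ∃ s : Finset (Set Y), (s : Set (Set Y)) ⊆ 𝒰 ∧ ⋃₀ (s : Set (Set Y)) = Set.univ := by
  obtain ⟨t, ht⟩ := isCompact_univ.elim_finite_subcover (fun U : 𝒰 => (U : Set Y))
    (fun U => h.1 U U.2) (by rw [← Set.sUnion_eq_iUnion, h.2])
  refine ⟨t.map (Function.Embedding.subtype _), by simp, Set.eq_univ_of_univ_subset ?_⟩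
  simpa [Set.sUnion_eq_biUnion] using ht

lemma isOpenCover'_iteratedJoin (T : Y ≃ₜ Y) {𝒰 : Set (Set Y)} (h : IsOpenCover' 𝒰) (n : ℕ) :
    IsOpenCover' (iteratedJoin T 𝒰 n) := by
  refine ⟨?_, Set.eq_univ_of_forall fun y => ?_⟩
  · rintro _ ⟨c, hc, rfl⟩
    exact isOpen_biInter_finset fun i _ => (T ^ i).isOpenMap _ (h.1 _ (hc i))
  · have hy : ∀ i : ℕ, ∃ U ∈ 𝒰, (T ^ i).symm y ∈ U := fun i =>
      Set.mem_sUnion.1 (h.2 ▸ Set.mem_univ _)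
    choose c hc hyc using hy
    refine ⟨_, ⟨c, hc, rfl⟩, Set.mem_iInter₂.2 fun i _ => ⟨_, hyc i, ?_⟩⟩
    exact (T ^ i).apply_symm_apply y

/-- Constant choices put every member of `𝒰` into each join, so one finite subcover serves all `n ≥
1` and the cover numbers stay bounded. -/
lemma topEntropy_refl_le [CompactSpace Y] : topEntropy (Homeomorph.refl Y) ≤ 0 := by
  refine iSup₂_le fun 𝒰 h𝒰 => ?_
  obtain ⟨s, hs, hcov⟩ := h𝒰.exists_finset
  have hone : ∀ i : ℕ, (Homeomorph.refl Y) ^ i = Homeomorph.refl Y := fun i => one_pow i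
  have hle : ∀ n : ℕ, 1 ≤ n →
      coverNumber (iteratedJoin (Homeomorph.refl Y) 𝒰 n) ≤ s.card + 1 := by
    intro n hn
    refine (coverNumber_le (fun U hU => ?_) hcov).trans (Nat.le_succ _)
    refine ⟨fun _ => U, fun _ => hs hU, ?_⟩
    ext y
    simp only [hone, Homeomorph.refl_apply, id_eq, Set.image_id', Set.mem_iInter, Finset.mem_Icc]
    exact ⟨fun h _ _ => h, fun h => h 1 ⟨le_rfl, hn⟩⟩
  have hlim : Filter.Tendsto
      (fun n : ℕ => ((Real.log ((s.card + 1 : ℕ) : ℝ) / (n : ℝ) : ℝ) : EReal))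
      Filter.atTop (nhds 0) :=
    continuous_coe_real_ereal.continuousAt.tendsto.comp
      (tendsto_const_div_atTop_nhds_zero_nat (Real.log ((s.card + 1 : ℕ) : ℝ)))
  rw [← hlim.limsup_eq]
  refine Filter.limsup_le_limsup (Filter.eventually_atTop.2 ⟨1, fun n hn => ?_⟩)
  refine EReal.coe_le_coe_iff.2 (div_le_div_of_nonneg_right ?_ (Nat.cast_nonneg n))
  rcases Nat.eq_zero_or_pos (coverNumber (iteratedJoin (Homeomorph.refl Y) 𝒰 n)) with h | h
  · rw [h, Nat.cast_zero, Real.log_zero]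
    exact Real.log_natCast_nonneg _
  · exact Real.log_le_log (by exact_mod_cast h) (by exact_mod_cast hle n hn)

lemma isOpenCover'_clopen {U : Set Y} (hU : IsClopen U) : IsOpenCover' {U, Uᶜ} := by
  refine ⟨?_, by simp⟩
  rintro _ (rfl | rfl)
  · exact hU.isOpen
  · exact hU.compl.isOpen

/-- Points which visit a clopen set freely along a set of times of positive density force positive
entropy. -/
lemma topEntropy_pos [CompactSpace Y] (T : Y ≃ₜ Y) {U : Set Y} (hU : IsClopen U) {L : ℕ}
    (hL : 0 < L)
    (h : ∀ k : ℕ, ∃ (y : (Fin k → Bool) → Y) (e : Fin k → ℕ),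
      (∀ j, 1 ≤ e j ∧ e j ≤ k * L) ∧ ∀ ω j, (T ^ e j).symm (y ω) ∈ U ↔ ω j = true) :
    0 < topEntropy T := by
  have hcov := isOpenCover'_clopen hU
  have key : ∀ k : ℕ, 2 ^ k ≤ coverNumber (iteratedJoin T {U, Uᶜ} (k * L)) := by
    intro k
    obtain ⟨y, e, he, hy⟩ := h k
    -- A finite subcover must exist, since otherwise `sInf ∅ = 0` would defeat the lower bound.
    obtain ⟨s₀, hs₀, hcov₀⟩ := (isOpenCover'_iteratedJoin T hcov (k * L)).exists_finset
    refine le_csInf ⟨_, s₀, hs₀, hcov₀, rfl⟩ ?_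
    rintro _ ⟨s, hs, hscov, rfl⟩
    have hmem : ∀ ω, ∃ V ∈ s, y ω ∈ V := fun ω =>
      Set.mem_sUnion.1 (hscov ▸ Set.mem_univ (y ω))
    choose V hVs hyV using hmem
    -- A member of the join prescribes `U` or `Uᶜ` at every time `e j`, so it contains `y ω` for one
    -- `ω` only.
    have hinj : Function.Injective V := by
      intro ω ω' hV
      ext1 j
      obtain ⟨c, hc, hcV⟩ := hs (hVs ω)
      have hin : ∀ ω'', y ω'' ∈ V ω → (T ^ e j).symm (y ω'') ∈ c (e j) := by
        intro ω'' hω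
        rw [hcV] at hω
        obtain ⟨z, hz, hzy⟩ := Set.mem_iInter₂.1 hω (e j) (Finset.mem_Icc.2 (he j))
        rw [← hzy]
        simpa using hz
      have h₁ := hin ω (hyV ω)
      have h₂ := hin ω' (hV ▸ hyV ω')
      have hiff : (T ^ e j).symm (y ω) ∈ U ↔ (T ^ e j).symm (y ω') ∈ U := by
        rcases hc (e j) with h | h
        · rw [h] at h₁ h₂
          exact iff_of_true h₁ h₂
        · rw [h] at h₁ h₂
          exact iff_of_false h₁ h₂
      rw [hy, hy] at hiff
      exact Bool.eq_iff_iff.2 hiff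
    calc 2 ^ k = Fintype.card (Fin k → Bool) := by simp
      _ = (Finset.univ.image V).card := by
        rw [Finset.card_image_of_injective _ hinj, Finset.card_univ]
      _ ≤ s.card := Finset.card_le_card fun W hW => by
        obtain ⟨ω, -, rfl⟩ := Finset.mem_image.1 hW
        exact hVs ω
  have hL' : (0 : ℝ) < L := by exact_mod_cast hL
  have hpos : (0 : EReal) < ((Real.log 2 / L : ℝ) : EReal) :=
    EReal.coe_pos.2 (div_pos (Real.log_pos one_lt_two) hL')
  refine hpos.trans_le (le_trans ?_ (le_iSup₂ (f := fun (𝒰 : Set (Set Y))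
    (_ : IsOpenCover' 𝒰) => Filter.limsup (fun n : ℕ =>
      ((Real.log (coverNumber (iteratedJoin T 𝒰 n) : ℝ) / (n : ℝ) : ℝ) : EReal)) Filter.atTop)
    {U, Uᶜ} hcov))
  -- For the upper limit, the positive multiples of `L` are enough times.
  refine Filter.le_limsup_of_frequently_le (Filter.frequently_atTop.2 fun n => ?_)
  refine ⟨(n + 1) * L, by nlinarith, EReal.coe_le_coe_iff.2 ?_⟩
  have hlog : ((n + 1 : ℕ) : ℝ) * Real.log 2
      ≤ Real.log (coverNumber (iteratedJoin T {U, Uᶜ} ((n + 1) * L)) : ℝ) := by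
    rw [← Real.log_pow]
    exact Real.log_le_log (by positivity) (by exact_mod_cast key (n + 1))
  rw [div_le_div_iff₀ hL' (by positivity)]
  push_cast at hlog ⊢
  nlinarith

end Entropy

/-! ### Free concatenation of gap insertions of a periodic sequence -/

section Gluing

/-- A function on `[0, P]` from `0` to `8 M` with admissible steps which follows `p` in the
middle. -/
lemma IsGapPos.exists_block {p : ℤ → ℤ} (hp : IsGapPos p) {N M : ℤ} (hN : 0 ≤ N) (hM : 0 < M)
    (h₁ : |p (-N)| ≤ M) (h₂ : |p N| ≤ M) :
    ∃ b : ℤ → ℤ, b 0 = 0 ∧ b (2 * (N + M)) = 8 * M ∧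
      (∀ i, b i + 3 ≤ b (i + 1) ∧ b (i + 1) ≤ b i + 5) ∧
      ∀ i, -N ≤ i → i ≤ N → b (N + M + i) = p i + 4 * M := by
  rw [abs_le] at h₁ h₂
  -- The outer pieces have `M` steps each: `3` per step, plus an excess of at most `2` per step
  -- until the totals `p (-N) + M` and `M - p N`, both in `[0, 2 * M]`, are used up. Thus the end
  -- value `8 * M` does not depend on `p`.
  refine ⟨fun i => if i ≤ M then 3 * i + min (2 * max i 0) (p (-N) + M)
    else if i ≤ M + 2 * N then p (i - N - M) + 4 * M
    else p N + 4 * M + (3 * (i - M - 2 * N) + min (2 * (i - M - 2 * N)) (M - p N)), ?_, ?_, ?_, ?_⟩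
  · grind
  · grind
  · intro i
    have h := hp (i - N - M)
    rw [show i - N - M + 1 = i + 1 - N - M by ring] at h
    have hi₁ : i = M → i - N - M = -N := by lia
    have hi₂ : i = M + 2 * N → i - N - M = N := by lia
    grind
  · intro i h1 h2
    have e : N + M + i - N - M = i := by ring
    grind

/-- Concatenating blocks of positions in any order. -/
lemma isGapPos_glue {P L : ℤ} (hP : 0 < P) {b : Bool → ℤ → ℤ} (h0 : ∀ o, b o 0 = 0)
    (hL : ∀ o, b o P = L) (hb : ∀ o i, b o i + 3 ≤ b o (i + 1) ∧ b o (i + 1) ≤ b o i + 5)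
    (ω : ℤ → Bool) : IsGapPos fun i => i / P * L + b (ω (i / P)) (i % P) := by
  intro i
  have h := hb (ω (i / P)) (i % P)
  have hlt := Int.emod_lt_of_pos i hP
  have hnn := Int.emod_nonneg i hP.ne'
  have hdm := Int.mul_ediv_add_emod i P
  -- At a block boundary the old block ends at `L`, where the new one starts, whichever it is.
  rcases (show i % P + 1 ≤ P by lia).lt_or_eq with hlt' | heq
  · have hd : (i + 1) / P = i / P := by
      rw [Int.ediv_eq_iff_of_pos hP]
      constructor <;> nlinarith
    have hm : (i + 1) % P = i % P + 1 := by
      rw [Int.emod_def, hd]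
      lia
    simp only [hd, hm]
    lia
  · have hd : (i + 1) / P = i / P + 1 := by
      rw [Int.ediv_eq_iff_of_pos hP]
      constructor <;> nlinarith
    have hm : (i + 1) % P = 0 := by
      rw [Int.emod_def, hd]
      nlinarith
    rw [heq, hL] at h
    simp only [hd, hm, h0]
    constructor <;> nlinarith

lemma shift_mul_of_periodic {A : Type u} {x : ℤ → A} {q : ℤ} (hx : ∀ i, x (i + q) = x i)
    (k i : ℤ) : x (k * q + i) = x i := by
  have h : Function.Periodic x q := hx
  rw [add_comm]
  exact h.int_mul k i

/-- Any two gap insertions of a periodic sequence can be freely alternated. -/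
lemma exists_free_concatenation {A : Type u} {x : ℤ → A} {q : ℤ} (hq : 0 < q)
    (hx : ∀ i, x (i + q) = x i) {p : Bool → ℤ → ℤ} (hp : ∀ o, IsGapPos (p o)) (r : ℕ) :
    ∃ L s : ℤ, 0 ≤ s ∧ s < L ∧ ∀ ω : ℤ → Bool, ∃ p' : ℤ → ℤ, IsGapPos p' ∧
      ∀ k j : ℤ, |j| ≤ r →
        insertGaps x p' (j + (k * L + s)) = insertGaps x (p (ω k)) j := by
  obtain ⟨n, hn⟩ : ∃ n : ℤ, 0 ≤ n ∧ ∀ o, r + |p o 0| ≤ n :=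
    ⟨r + |p true 0| + |p false 0|, by positivity, by rintro (_ | _) <;> grind⟩
  -- `N` is large enough for the positions with indices in `[-N, N]` to span `[-r, r]`. Both `N` and
  -- `M` are multiples of `q`, so the middle of every block meets the periodic letters in the same
  -- phase.
  obtain ⟨N, hN, hN0, hNq⟩ : ∃ N, n ≤ N ∧ 0 ≤ N ∧ q ∣ N :=
    ⟨q * n, by nlinarith, by nlinarith, dvd_mul_right _ _⟩
  have hlo : ∀ o, p o (-N) ≤ -r := fun o => by
    have h1 := (hp o).add_int (-N) hN0
    have h2 := hn.2 o
    rw [neg_add_cancel] at h1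
    grind
  have hhi : ∀ o, r ≤ p o N := fun o => by
    have h1 := (hp o).add_int 0 hN0
    have h2 := hn.2 o
    rw [zero_add] at h1
    grind
  obtain ⟨m, hm0, hm⟩ : ∃ m : ℤ, 0 < m ∧ ∀ o, |p o (-N)| ≤ m ∧ |p o N| ≤ m :=
    ⟨|p true (-N)| + |p false (-N)| + |p true N| + |p false N| + 1, by positivity,
      by rintro (_ | _) <;> grind⟩
  obtain ⟨M, hM, hM0, hMq⟩ : ∃ M, m ≤ M ∧ 0 < M ∧ q ∣ M :=
    ⟨q * m, by nlinarith, by nlinarith, dvd_mul_right _ _⟩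
  choose b hb0 hbL hb hbp using fun o => (hp o).exists_block hN0 hM0
    ((hm o).1.trans hM) ((hm o).2.trans hM)
  have hP : 0 < 2 * (N + M) := by lia
  refine ⟨8 * M, 4 * M, by lia, by lia, fun ω => ⟨_, isGapPos_glue hP hb0 hbL hb ω, ?_⟩⟩
  intro k j hj
  rw [abs_le] at hj
  refine insertGaps_congr (m := -N) (n := N) (s := k * (2 * (N + M)) + (N + M))
    (hp _).strictMono (isGapPos_glue hP hb0 hbL hb ω).strictMono ?_ ?_ (by lia)
    ((hlo _).trans hj.1) (hj.2.trans (hhi _))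
  · intro i h1 h2
    have hd : (k * (2 * (N + M)) + (N + M) + i) / (2 * (N + M)) = k := by
      rw [Int.ediv_eq_iff_of_pos hP]
      constructor <;> lia
    have hm : (k * (2 * (N + M)) + (N + M) + i) % (2 * (N + M)) = N + M + i := by
      rw [Int.emod_def, hd]
      ring
    simp only [hd, hm, hbp _ i h1 h2]
    ring
  · intro i _ _
    obtain ⟨c, hc⟩ : q ∣ k * (2 * (N + M)) + (N + M) :=
      dvd_add (dvd_mul_of_dvd_right (dvd_mul_of_dvd_right (dvd_add hNq hMq) _) _)
        (dvd_add hNq hMq)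
    rw [hc, mul_comm]
    exact shift_mul_of_periodic hx c i

end Gluing

/-! ### Clopen sets in factors of zero entropy -/

section Factors

lemma IsFactorMap.iterate {X Y : Type u} [TopologicalSpace X] [TopologicalSpace Y]
    {T : X ≃ₜ X} {S : Y ≃ₜ Y} {φ : X → Y} (h : IsFactorMap T S φ) (n : ℕ) (x : X) :
    φ ((T ^ n) x) = (S ^ n) (φ x) := by
  induction n with
  | zero => rfl
  | succ n ih =>
    rw [pow_succ', pow_succ']
    exact (h.commutes _).trans (congrArg S ih)

lemma shiftHomeo_pow {A : Type u} [TopologicalSpace A] [CompactSpace A] (X : Subshift A ℤ)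
    (n : ℕ) (x : X.carrier) : ((shiftHomeo X ^ n) x : ℤ → A) = shift (n : ℤ) x.1 := by
  induction n with
  | zero => exact (shift_zero x.1).symm
  | succ n ih =>
    rw [pow_succ']
    change shift 1 ((shiftHomeo X ^ n) x : ℤ → A) = _
    rw [ih, ← shift_add]
    push_cast
    rfl

lemma exists_forall_mem_of_isOpen {A : Type u} [TopologicalSpace A] [DiscreteTopology A]
    {X : Set (ℤ → A)} {W : Set X} (hW : IsOpen W) {c : X} (hc : c ∈ W) :
    ∃ r : ℕ, ∀ c' : X, (∀ j : ℤ, |j| ≤ r → c'.1 j = c.1 j) → c' ∈ W := by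
  obtain ⟨O, hO, rfl⟩ := isOpen_induced_iff.1 hW
  obtain ⟨I, u, hu, hsub⟩ := isOpen_pi_iff.1 hO c.1 hc
  refine ⟨I.sup Int.natAbs, fun c' hc' => hsub fun i hi => ?_⟩
  have := Finset.le_sup (f := Int.natAbs) hi
  rw [hc' i (by rw [Int.abs_eq_natAbs]; exact_mod_cast this)]
  exact (hu i hi).2

lemma exists_forall_mem_iff_of_isClopen {A : Type u} [TopologicalSpace A] [DiscreteTopology A]
    {X : Set (ℤ → A)} {W : Set X} (hW : IsClopen W) (c : X) :
    ∃ r : ℕ, ∀ c' : X, (∀ j : ℤ, |j| ≤ r → c'.1 j = c.1 j) → (c' ∈ W ↔ c ∈ W) := by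
  by_cases hc : c ∈ W
  · obtain ⟨r, hr⟩ := exists_forall_mem_of_isOpen hW.isOpen hc
    exact ⟨r, fun c' h => iff_of_true (hr c' h) hc⟩
  · obtain ⟨r, hr⟩ := exists_forall_mem_of_isOpen hW.compl.isOpen hc
    exact ⟨r, fun c' h => iff_of_false (hr c' h) hc⟩

/-- A clopen set of a factor of zero entropy cannot distinguish two gap insertions of one periodic
sequence. -/
lemma mem_iff_of_periodic {A : Type u} [CompactSpace (Gapped A)] {X : Subshift (Gapped A) ℤ}
    {Y : Type u} [TopologicalSpace Y]
    [CompactSpace Y] {S : Y ≃ₜ Y} {φ : X.carrier → Y} (hφ : IsFactorMap (shiftHomeo X) S φ)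
    (hS : ¬ 0 < topEntropy S) {U : Set Y} (hU : IsClopen U) {x : ℤ → A} {q : ℤ} (hq : 0 < q)
    (hx : ∀ i, x (i + q) = x i) (hX : ∀ p, IsGapPos p → insertGaps x p ∈ X.carrier)
    {p p' : ℤ → ℤ} (hp : IsGapPos p) (hp' : IsGapPos p') (h : φ ⟨_, hX p hp⟩ ∈ U) :
    φ ⟨_, hX p' hp'⟩ ∈ U := by
  by_contra h'
  refine hS ?_
  have hW : IsClopen (φ ⁻¹' U) := hU.preimage hφ.continuous
  obtain ⟨r₁, hr₁⟩ := exists_forall_mem_iff_of_isClopen hW ⟨_, hX p hp⟩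
  obtain ⟨r₂, hr₂⟩ := exists_forall_mem_iff_of_isClopen hW ⟨_, hX p' hp'⟩
  obtain ⟨L, s, hs, hsL, hfree⟩ := exists_free_concatenation hq hx
    (p := fun o => if o then p else p') (by rintro (_ | _) <;> simpa) (max r₁ r₂)
  choose p'' hgap hagree using hfree
  lift L to ℕ using by lia
  lift s to ℕ using hs
  refine topEntropy_pos S hU (L := L) (by lia) fun k => ?_
  -- Entropy is defined through forward images, so the points are pulled back in time. The choices
  -- therefore go into the negative blocks: block `-(j + 1)` is centred at `-((j + 1) * L - s)`. The
  -- other values of `ext` do not matter.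
  let ext (ω : Fin k → Bool) (z : ℤ) : Bool :=
    if hz : (-z - 1).toNat < k then ω ⟨(-z - 1).toNat, hz⟩ else false
  refine ⟨fun ω => φ ⟨_, hX _ (hgap (ext ω))⟩, fun j => (j + 1) * L - s, fun j => ?_,
    fun ω j => ?_⟩
  · have hs : s < L := by exact_mod_cast hsL
    exact ⟨Nat.sub_pos_of_lt (hs.trans_le (Nat.le_mul_of_pos_left L (Nat.succ_pos _))),
      (Nat.sub_le _ _).trans (Nat.mul_le_mul_right L j.2)⟩
  have hLe : s ≤ (j + 1) * L :=
    (show s ≤ L by lia).trans (Nat.le_mul_of_pos_left L (Nat.succ_pos _))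
  let e : ℕ := (j + 1) * L - s
  let z : X.carrier := ⟨_, hX _ (hgap (ext ω))⟩
  let w : X.carrier := ⟨shift (-(e : ℤ)) z.1, X.mapsTo _ z.2⟩
  have hw : (shiftHomeo X ^ e) w = z := by
    refine Subtype.ext ?_
    rw [shiftHomeo_pow, ← shift_add, neg_add_cancel, shift_zero]
  have hφw : (S ^ e).symm (φ z) = φ w := by
    rw [← hw, hφ.iterate, Homeomorph.symm_apply_apply]
  change (S ^ e).symm (φ z) ∈ U ↔ _
  rw [hφw]
  have hext : ext ω (-(j + 1)) = ω j := by
    simp [ext]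
  have hwj : ∀ i : ℤ, |i| ≤ (max r₁ r₂ : ℕ) →
      w.1 i = insertGaps x (if ω j then p else p') i := by
    intro i hi
    rw [← hext, ← hagree (ext ω) (-(j + 1)) i hi]
    change insertGaps x _ (-(e : ℤ) + i) = _
    congr 1
    simp only [e]
    push_cast [hLe]
    ring
  rcases hj : ω j with _ | _
  · have : w ∈ φ ⁻¹' U ↔ _ := hr₂ w fun i hi => by
      rw [hwj i (hi.trans (by exact_mod_cast le_max_right r₁ r₂)), hj]
      rfl
    simpa [h'] using this
  · have : w ∈ φ ⁻¹' U ↔ _ := hr₁ w fun i hi => by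
      rw [hwj i (hi.trans (by exact_mod_cast le_max_left r₁ r₂)), hj]
      rfl
    simpa [h] using this

end Factors

/-! ### Approximation by mechanical sequences of rational slope -/

section Approximation

/-- Finitely many symbols of a balanced sequence are those of a mechanical sequence of rational
slope. -/
lemma IsKBalanced.exists_mechanical_nonneg {x : ℤ → Fin 2} (hx : IsKBalanced 1 x) (N : ℕ) :
    ∃ β : ℚ, 0 < β ∧ β < 1 ∧ ∃ ρ : ℝ, ∀ k : ℕ, k < N → mechanical β ρ k = x k := by
  -- Finitely many lower estimates lie strictly below finitely many upper ones, so a rational `β`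
  -- fits between; `0` and `1` are added to force `0 < β < 1`.
  let I : Finset (ℕ × ℕ) := Finset.Icc 1 N ×ˢ Finset.range (N + 1)
  let A : Finset ℚ := insert 0 (I.image fun m => ((onesCount x m.2 m.1 : ℚ) - 1) / m.1)
  let B : Finset ℚ := insert 1 (I.image fun m => ((onesCount x m.2 m.1 : ℚ) + 1) / m.1)
  have hAB : ∀ a ∈ A, ∀ b ∈ B, a < b := by
    intro a ha b hb
    have hA : a = 0 ∨ ∃ m : ℕ, 0 < m ∧ ∃ i : ℕ, a = ((onesCount x i m : ℚ) - 1) / m := by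
      rcases Finset.mem_insert.1 ha with h | h
      · exact Or.inl h
      · obtain ⟨⟨m, i⟩, hm, rfl⟩ := Finset.mem_image.1 h
        exact Or.inr ⟨m, (Finset.mem_Icc.1 (Finset.mem_product.1 hm).1).1, i, rfl⟩
    have hB : b = 1 ∨ ∃ m : ℕ, 0 < m ∧ ∃ i : ℕ, b = ((onesCount x i m : ℚ) + 1) / m := by
      rcases Finset.mem_insert.1 hb with h | h
      · exact Or.inl h
      · obtain ⟨⟨m, i⟩, hm, rfl⟩ := Finset.mem_image.1 h
        exact Or.inr ⟨m, (Finset.mem_Icc.1 (Finset.mem_product.1 hm).1).1, i, rfl⟩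
    rcases hA with rfl | ⟨m, hm, i, rfl⟩
    · rcases hB with rfl | ⟨n, hn, j, rfl⟩
      · exact one_pos
      · positivity
    · have hm' : (0 : ℚ) < m := by exact_mod_cast hm
      rcases hB with rfl | ⟨n, hn, j, rfl⟩
      · rw [div_lt_one hm']
        have : (onesCount x i m : ℚ) ≤ m := by exact_mod_cast onesCount_le x i m
        linarith
      · rw [div_lt_div_iff₀ hm' (by exact_mod_cast hn)]
        exact_mod_cast hx.cross_lt hm hn i j
  obtain ⟨β, hβA, hβB⟩ := Order.exists_between_finsets (lo := A) (hi := B) hAB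
  have hβ0 : 0 < β := hβA 0 (Finset.mem_insert_self _ _)
  have hβ1 : β < 1 := hβB 1 (Finset.mem_insert_self _ _)
  have hlt : ∀ i n : ℕ, 1 ≤ n → i + n ≤ N →
      (onesCount x i n : ℝ) - 1 < β * n ∧ β * n < (onesCount x i n : ℝ) + 1 := by
    intro i n hn hin
    have hmem : (n, i) ∈ I :=
      Finset.mem_product.2 ⟨Finset.mem_Icc.2 ⟨hn, by lia⟩, Finset.mem_range.2 (by lia)⟩
    have hn' : (0 : ℚ) < n := by exact_mod_cast hn
    have h1 := hβA _ (Finset.mem_insert_of_mem (Finset.mem_image_of_mem _ hmem))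
    have h2 := hβB _ (Finset.mem_insert_of_mem (Finset.mem_image_of_mem _ hmem))
    rw [div_lt_iff₀ hn'] at h1
    rw [lt_div_iff₀ hn'] at h2
    exact ⟨by exact_mod_cast h1, by exact_mod_cast h2⟩
  -- The line of slope `β` is lowered until it touches the graph of prefix counts from above, at
  -- `l`. It then stays less than `1` above the graph by `hlt`, so its floors are the counts.
  obtain ⟨l, hl, hmax⟩ := Finset.exists_max_image (Finset.range (N + 1))
    (fun k => (onesCount x 0 k : ℝ) - β * k) ⟨0, by simp⟩
  rw [Finset.mem_range] at hl
  have hfloor : ∀ k : ℕ, k ≤ N →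
      ⌊(β : ℝ) * k + ((onesCount x 0 l : ℝ) - β * l)⌋ = onesCount x 0 k := by
    intro k hk
    have h1 := hmax k (Finset.mem_range.2 (by lia))
    rw [Int.floor_eq_iff]
    refine ⟨by push_cast; linarith, ?_⟩
    push_cast
    rcases lt_trichotomy k l with hkl | rfl | hkl
    · obtain ⟨n, rfl⟩ := Nat.exists_eq_add_of_lt hkl
      have h2 := (hlt k (n + 1) (by lia) (by lia)).1
      rw [add_assoc k n 1, onesCount_add, zero_add]
      push_cast at h2 ⊢
      linarith
    · linarith
    · obtain ⟨n, rfl⟩ := Nat.exists_eq_add_of_lt hkl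
      have h2 := (hlt l (n + 1) (by lia) (by lia)).2
      rw [add_assoc l n 1, onesCount_add, zero_add]
      push_cast at h2 ⊢
      linarith
  refine ⟨β, hβ0, hβ1, (onesCount x 0 l : ℝ) - β * l, fun k hk => Fin.ext ?_⟩
  have hmech := mechanical_val (β := β)
    ⟨by exact_mod_cast hβ0.le, by exact_mod_cast hβ1.le⟩ ((onesCount x 0 l : ℝ) - β * l) k
  have h1 := hfloor k hk.le
  have h2 := hfloor (k + 1) hk
  push_cast at hmech h1 h2
  rw [h1, h2, onesCount_succ, zero_add] at hmech
  push_cast at hmech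
  lia

lemma IsKBalanced.exists_mechanical {x : ℤ → Fin 2} (hx : IsKBalanced 1 x) (r : ℕ) :
    ∃ β : ℚ, 0 < β ∧ β < 1 ∧ ∃ ρ : ℝ, ∀ k : ℤ, |k| ≤ r → mechanical β ρ k = x k := by
  obtain ⟨β, h0, h1, ρ, h⟩ := (hx.shift (-(r : ℤ))).exists_mechanical_nonneg (2 * r + 1)
  refine ⟨β, h0, h1, β * (r : ℤ) + ρ, fun k hk => ?_⟩
  rw [abs_le] at hk
  have := h (r + k).toNat (by lia)
  rw [Int.toNat_of_nonneg (by lia), shift_apply, neg_add_cancel_left] at this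
  rw [← this, ← shift_mechanical, shift_apply]

lemma mechanical_periodic (β : ℚ) (ρ : ℝ) (i : ℤ) :
    mechanical β ρ (i + β.den) = mechanical β ρ i := by
  have h : (β : ℝ) * ((β.den : ℤ) : ℝ) = (β.num : ℝ) := by
    exact_mod_cast Rat.mul_den_eq_num β
  rw [add_comm, ← shift_apply (β.den : ℤ) (mechanical β ρ) i, shift_mechanical, h, add_comm,
    mechanical_add_int]

/-- The numbers `β * n` are multiples of `1 / β.den`, so the floors see the intercept only up to
that precision. -/
lemma mechanical_floor (β : ℚ) (ρ : ℝ) :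
    mechanical β ρ = mechanical β ((⌊β.den * ρ⌋ : ℝ) / β.den) := by
  have hden : (0 : ℝ) < β.den := by exact_mod_cast β.den_pos
  have hβ : (β : ℝ) * β.den = β.num := by exact_mod_cast Rat.mul_den_eq_num β
  have key : ∀ n : ℤ, ⌊(β : ℝ) * n + ρ⌋ = ⌊(β : ℝ) * n + (⌊β.den * ρ⌋ : ℝ) / β.den⌋ := by
    intro n
    refine eq_of_forall_le_iff fun z => ?_
    have h1 : (z : ℝ) ≤ β * n + ρ ↔ ((z * β.den - β.num * n : ℤ) : ℝ) ≤ β.den * ρ := by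
      rw [← mul_le_mul_iff_left₀ hden]
      push_cast
      rw [← hβ, sub_le_iff_le_add]
      ring_nf
    have h2 : (z : ℝ) ≤ β * n + (⌊β.den * ρ⌋ : ℝ) / β.den ↔
        ((z * β.den - β.num * n : ℤ) : ℝ) ≤ ⌊β.den * ρ⌋ := by
      rw [← mul_le_mul_iff_left₀ hden, add_mul, div_mul_cancel₀ _ hden.ne']
      push_cast
      rw [← hβ, sub_le_iff_le_add]
      ring_nf
    rw [Int.le_floor, Int.le_floor, h1, h2, Int.cast_le, Int.le_floor]
  ext1 n
  have h1 := key n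
  have h2 := key (n + 1)
  push_cast at h2
  simp only [mechanical, h1, h2]

/-- Mechanical sequences of the same rational slope are shifts of each other. -/
lemma exists_shift_mechanical_eq (β : ℚ) (ρ ρ' : ℝ) :
    ∃ t, mechanical β ρ' = shift t (mechanical β ρ) := by
  rw [mechanical_floor β ρ, mechanical_floor β ρ']
  generalize ⌊β.den * ρ⌋ = a
  generalize ⌊β.den * ρ'⌋ = a'
  have hden : (0 : ℝ) < β.den := by exact_mod_cast β.den_pos
  have hβ : (β : ℝ) * β.den = β.num := by exact_mod_cast Rat.mul_den_eq_num β
  -- By Bézout, a shift by `u * (a' - a)` moves the intercept by `(a' - a) / β.den` modulo `1`.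
  obtain ⟨u, v, huv⟩ : IsCoprime β.num (β.den : ℤ) := by
    rw [Int.isCoprime_iff_gcd_eq_one]
    exact β.reduced
  refine ⟨u * (a' - a), ?_⟩
  rw [shift_mechanical, ← mechanical_add_int β _ (v * (a - a'))]
  congr 1
  have huv' : (u : ℝ) * β.num + v * β.den = 1 := by exact_mod_cast huv
  rw [← hβ] at huv'
  field_simp
  push_cast
  linear_combination (a - a' : ℝ) * huv'

/-- For each slope there is a mechanical sequence whose symbols depend continuously on the
slope. -/
lemma exists_eventually_mechanical_eq (α : ℝ) :
    ∃ ρ : ℝ, ∀ r : ℕ, ∀ᶠ β in nhds α, ∀ k : ℤ, |k| ≤ r →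
      mechanical β ρ k = mechanical α ρ k := by
  -- Off this countable set of intercepts, `α * k + ρ` is never an integer, so each floor is locally
  -- constant in the slope.
  have hcount : (Set.range fun z : ℤ × ℤ => (z.1 : ℝ) - α * z.2).Countable :=
    Set.countable_range _
  obtain ⟨ρ, hρ⟩ := (hcount.dense_compl ℝ).nonempty
  have hfloor : ∀ k : ℤ, ∀ᶠ β in nhds α, ⌊β * k + ρ⌋ = ⌊α * k + ρ⌋ := by
    intro k
    have hne : (⌊α * k + ρ⌋ : ℝ) ≠ α * k + ρ := fun h =>
      hρ ⟨(⌊α * k + ρ⌋, k), by simp only [h]; ring⟩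
    have hcont : Continuous fun β : ℝ => β * k + ρ := by fun_prop
    filter_upwards [hcont.tendsto α |>.eventually (Ioo_mem_nhds
      (lt_of_le_of_ne (Int.floor_le _) hne) (Int.lt_floor_add_one _))] with β hβ
    exact Int.floor_eq_iff.2 ⟨hβ.1.le, hβ.2⟩
  refine ⟨ρ, fun r => ?_⟩
  have hall : ∀ᶠ β in nhds α, ∀ k ∈ Finset.Icc (-(r : ℤ)) r,
      mechanical β ρ k = mechanical α ρ k := by
    rw [Filter.eventually_all_finset]
    intro k _
    filter_upwards [hfloor k, hfloor (k + 1)] with β h1 h2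
    push_cast at h2
    simp only [mechanical, h1, h2]
  filter_upwards [hall] with β hβ k hk
  exact hβ k (Finset.mem_Icc.2 (abs_le.1 hk))

end Approximation

/-! ### Clopen sets that do not distinguish gap insertions of periodic sequences -/

section Connectedness

/-- Positions spread at least as fast as indices, so the indices up to `r + |p 0|` cover the window.
-/
lemma IsGapPos.exists_insertGaps_congr {A : Type*} {p : ℤ → ℤ} (hp : IsGapPos p) (r : ℕ) :
    ∃ n : ℕ, ∀ a b : ℤ → A, (∀ i : ℤ, |i| ≤ n → b i = a i) →
      ∀ j : ℤ, |j| ≤ r → insertGaps b p j = insertGaps a p j := by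
  refine ⟨r + (p 0).natAbs, fun a b hab j hj => ?_⟩
  rw [abs_le] at hj
  set n : ℤ := ((r + (p 0).natAbs : ℕ) : ℤ) with hn
  have h1 := hp.add_int 0 (n := n) (by lia)
  have h2 := hp.add_int (-n) (n := n) (by lia)
  rw [zero_add] at h1
  rw [neg_add_cancel] at h2
  have := insertGaps_congr (a := a) (b := b) hp.strictMono hp.strictMono (m := -n) (n := n)
    (s := 0) (d := 0) (by simp) (fun i hi hi' => by rw [zero_add]; exact hab i (abs_le.2 ⟨hi, hi'⟩))
    (by lia) (j := j) (by lia) (by lia)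
  rwa [add_zero] at this

/-- A set `W` of sequences which is determined locally on `f(B)`, and which contains all or no gap
insertions of each periodic balanced sequence, contains all or no points of `f(B)`. -/
lemma mem_iff_of_locally_determined {W : Set (ℤ → Gapped (Fin 2))}
    (hloc : ∀ c ∈ blackBox balancedSet, ∃ r : ℕ, ∀ c' ∈ blackBox balancedSet,
      (∀ j : ℤ, |j| ≤ r → c' j = c j) → (c' ∈ W ↔ c ∈ W))
    (hper : ∀ x q, 0 < q → IsKBalanced 1 x → (∀ i, x (i + q) = x i) → ∀ p p', IsGapPos p →
      IsGapPos p' → insertGaps x p ∈ W → insertGaps x p' ∈ W)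
    {c c' : ℤ → Gapped (Fin 2)} (hc : c ∈ blackBox balancedSet)
    (hc' : c' ∈ blackBox balancedSet) (hcW : c ∈ W) : c' ∈ W := by
  have hmem : ∀ {a : ℤ → Fin 2} {p : ℤ → ℤ}, IsKBalanced 1 a → IsGapPos p →
      insertGaps a p ∈ blackBox balancedSet := fun ha hp => insertGaps_mem_gappedBalanced ha hp
  have hIcc : ∀ {β : ℝ}, β ∈ Set.Ioo (0 : ℝ) 1 → β ∈ Set.Icc (0 : ℝ) 1 :=
    fun h => Set.Ioo_subset_Icc_self h
  have hrat : ∀ {β : ℚ}, 0 < β → β < 1 → (β : ℝ) ∈ Set.Ioo (0 : ℝ) 1 := fun h0 h1 =>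
    ⟨by exact_mod_cast h0, by exact_mod_cast h1⟩
  -- A change of intercept is a shift of the letters, which reindexing absorbs into the positions;
  -- `hper` then changes the positions.
  have hslope : ∀ β : ℚ, (β : ℝ) ∈ Set.Ioo (0 : ℝ) 1 → ∀ ρ ρ' p p', IsGapPos p → IsGapPos p' →
      (insertGaps (mechanical β ρ) p ∈ W ↔ insertGaps (mechanical β ρ') p' ∈ W) := by
    have key : ∀ β : ℚ, (β : ℝ) ∈ Set.Ioo (0 : ℝ) 1 → ∀ ρ ρ' p p', IsGapPos p → IsGapPos p' →
        insertGaps (mechanical β ρ) p ∈ W → insertGaps (mechanical β ρ') p' ∈ W := by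
      intro β hβ ρ ρ' p p' hp hp' h
      obtain ⟨t, ht⟩ := exists_shift_mechanical_eq β ρ ρ'
      rw [insertGaps_reindex hp.strictMono.injective t, ← ht] at h
      exact hper _ β.den (by exact_mod_cast β.den_pos) (isKBalanced_mechanical (hIcc hβ) ρ')
        (mechanical_periodic β ρ') _ _ (by simpa using hp.const_add t 0) hp' h
    exact fun β hβ ρ ρ' p p' hp hp' => ⟨key β hβ _ _ _ _ hp hp', key β hβ _ _ _ _ hp' hp⟩
  have happrox : ∀ c ∈ blackBox balancedSet, ∃ β : ℚ, (β : ℝ) ∈ Set.Ioo (0 : ℝ) 1 ∧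
      (c ∈ W ↔ insertGaps (mechanical β 0) (fun i => 3 * i) ∈ W) := by
    intro c hc
    obtain ⟨r, hr⟩ := hloc c hc
    obtain ⟨a, ha, p, hp, rfl⟩ := (mem_blackBox_iff mapsTo_shift_balancedSet).1 hc
    obtain ⟨n, hn⟩ := hp.exists_insertGaps_congr (A := Fin 2) r
    obtain ⟨β, h0, h1, ρ, hβ⟩ := IsKBalanced.exists_mechanical ha n
    refine ⟨β, hrat h0 h1, ?_⟩
    rw [← hr _ (hmem (isKBalanced_mechanical (hIcc (hrat h0 h1)) ρ) hp) (hn _ _ hβ)]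
    exact hslope β (hrat h0 h1) _ _ _ _ hp isGapPos_three_mul
  -- `V Q` collects the slopes near which all rational slopes in `(0, 1)` give the truth value `Q`.
  -- Asking this of a neighbourhood makes it open and meaningful at irrational slopes.
  let V (Q : Prop) : Set ℝ := {α | ∀ᶠ β in nhds α, ∀ γ : ℚ, (γ : ℝ) = β → β ∈ Set.Ioo (0 : ℝ) 1 →
    (insertGaps (mechanical γ 0) (fun i => 3 * i) ∈ W ↔ Q)}
  have hVopen : ∀ Q, IsOpen (V Q) := fun Q =>
    isOpen_iff_eventually.2 fun α hα => eventually_eventually_nhds.2 hα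
  have hVcover : ∀ α ∈ Set.Ioo (0 : ℝ) 1, ∃ Q, α ∈ V Q := by
    intro α hα
    obtain ⟨ρ, hρ⟩ := exists_eventually_mechanical_eq α
    obtain ⟨r, hr⟩ := hloc _ (hmem (isKBalanced_mechanical (hIcc hα) ρ) isGapPos_three_mul)
    obtain ⟨n, hn⟩ := isGapPos_three_mul.exists_insertGaps_congr (A := Fin 2) r
    refine ⟨insertGaps (mechanical α ρ) (fun i => 3 * i) ∈ W, (hρ n).mono ?_⟩
    rintro _ hβ γ rfl hγ
    rw [← hr _ (hmem (isKBalanced_mechanical (hIcc hγ) ρ) isGapPos_three_mul) (hn _ _ hβ)]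
    exact hslope γ hγ _ _ _ _ isGapPos_three_mul isGapPos_three_mul
  have hself : ∀ {Q} {γ : ℚ}, (γ : ℝ) ∈ Set.Ioo (0 : ℝ) 1 → (γ : ℝ) ∈ V Q →
      (insertGaps (mechanical γ 0) (fun i => 3 * i) ∈ W ↔ Q) := fun hγ h =>
    h.self_of_nhds _ rfl hγ
  obtain ⟨β, hβ, hcβ⟩ := happrox c hc
  obtain ⟨β', hβ', hcβ'⟩ := happrox c' hc'
  rw [hcβ']
  rw [hcβ] at hcW
  by_contra hcW'
  have hmemV : ∀ {Q : Prop} {γ : ℚ}, (γ : ℝ) ∈ Set.Ioo (0 : ℝ) 1 →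
      (insertGaps (mechanical γ 0) (fun i => 3 * i) ∈ W ↔ Q) → (γ : ℝ) ∈ V Q := by
    intro Q γ hγ h
    obtain ⟨Q', hQ'⟩ := hVcover γ hγ
    rwa [← h, propext (hself hγ hQ')]
  -- If both truth values occurred, connectedness would make `V True` and `V False` meet inside `(0,
  -- 1)`, and their open intersection would contain a rational slope with both.
  obtain ⟨α, hα, hα₁, hα₂⟩ := isPreconnected_Ioo (V True) (V False) (hVopen _) (hVopen _)
    (fun α hα => by
      obtain ⟨Q, hQ⟩ := hVcover α hα
      by_cases h : Q
      · exact Or.inl (by rwa [eq_true h] at hQ)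
      · exact Or.inr (by rwa [eq_false h] at hQ))
    ⟨β, hβ, hmemV hβ (iff_true_intro hcW)⟩ ⟨β', hβ', hmemV hβ' (iff_false_intro hcW')⟩
  obtain ⟨_, ⟨⟨hα₁, hα₂⟩, hα⟩, γ, rfl⟩ := Rat.denseRange_cast.inter_open_nonempty _
    (((hVopen True).inter (hVopen False)).inter isOpen_Ioo) ⟨α, ⟨hα₁, hα₂⟩, hα⟩
  exact (hself hα hα₂).1 ((hself hα hα₁).2 trivial)

end Connectedness

/-! ### ZTCPE and the failure of TCPE for `f(B)` -/

section Main

theorem hasZTCPE_gappedBalanced : HasZTCPE (shiftHomeo gappedBalanced) := by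
  intro Y _ _ _ S φ hzero hφ hsurj
  by_cases hS : 0 < topEntropy S
  · exact Or.inl hS
  right
  have : Nonempty Y := (surjective_slope 0).nonempty.map φ
  refine Nat.card_eq_one_iff_unique.2 ⟨⟨fun y y' => ?_⟩, this⟩
  by_contra hne
  -- Zero-dimensionality enters only here, to separate two points by a clopen set.
  obtain ⟨U, hU, hyU, hsub⟩ := hzero.exists_subset_of_mem_open (a := y)
    (show y ∈ ({y'} : Set Y)ᶜ from hne) isOpen_compl_singleton
  have hU : IsClopen U := hU
  obtain ⟨c, rfl⟩ := hsurj y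
  obtain ⟨c', rfl⟩ := hsurj y'
  have hW : IsClopen (φ ⁻¹' U) := hU.preimage hφ.continuous
  have hiff : ∀ d : gappedBalanced.carrier,
      d.1 ∈ Subtype.val '' (φ ⁻¹' U) ↔ d ∈ φ ⁻¹' U := fun d =>
    Subtype.val_injective.mem_set_image
  refine hsub ((hiff c').1 (mem_iff_of_locally_determined ?_ ?_ c.2 c'.2 ((hiff c).2 hyU))) rfl
  · intro d hd
    obtain ⟨r, hr⟩ := exists_forall_mem_iff_of_isClopen hW ⟨d, hd⟩
    refine ⟨r, fun d' hd' h => ?_⟩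
    rw [hiff ⟨d', hd'⟩, hiff ⟨d, hd⟩]
    exact hr ⟨d', hd'⟩ h
  · intro x q hq hx hxq p p' hp hp' h
    have hX : ∀ p, IsGapPos p → insertGaps x p ∈ gappedBalanced.carrier := fun p hp =>
      insertGaps_mem_gappedBalanced hx hp
    rw [hiff ⟨_, hX p' hp'⟩]
    rw [hiff ⟨_, hX p hp⟩] at h
    exact mem_iff_of_periodic hφ hS hU hq hxq hX hp hp' h

theorem not_hasTCPE_gappedBalanced : ¬ HasTCPE (shiftHomeo gappedBalanced) := by
  intro h
  rcases h unitInterval _ slope isFactorMap_slope surjective_slope with h | h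
  · exact absurd h topEntropy_refl_le.not_gt
  · have := (Nat.card_eq_one_iff_unique.1 h).1
    exact zero_ne_one (Subsingleton.elim (0 : unitInterval) 1)

end Main

end TCPE

theorem mainTheorem2 :
    ∃ X : SymbolicDynamics.FullShift.Subshift (TCPE.Gapped (Fin 2)) ℤ,
      X.carrier = TCPE.blackBox TCPE.balancedSet ∧
      X.carrier.Nonempty ∧
      (∃ π : X.carrier → unitInterval,
        TCPE.IsFactorMap (TCPE.shiftHomeo X) (Homeomorph.refl unitInterval) π ∧
        Function.Surjective π ∧
        ∀ (c : X.carrier) (α : unitInterval),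
          π c = α ↔ (c : ℤ → TCPE.Gapped (Fin 2)) ∈
            TCPE.blackBox (TCPE.balancedSlopeSet (α : ℝ))) ∧
      TCPE.HasZTCPE (TCPE.shiftHomeo X) ∧
      ¬ TCPE.HasTCPE (TCPE.shiftHomeo X) := by
  obtain ⟨c, -⟩ := TCPE.surjective_slope 0
  exact ⟨TCPE.gappedBalanced, rfl, ⟨c.1, c.2⟩,
    ⟨TCPE.slope, TCPE.isFactorMap_slope, TCPE.surjective_slope, fun _ _ => TCPE.slope_eq_iff⟩,
    TCPE.hasZTCPE_gappedBalanced, TCPE.not_hasTCPE_gappedBalanced⟩
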